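/- Let $H,K,D\in\mathbb N$, let $\mathcal U$ be a set, let $p_\varepsilon$ be a probability density on $\mathbb R^D$ under which the coordinates of the noise $\varepsilon$ are independent, and let $Q_1,\dots,Q_H:\mathbb R\to[0,\infty)$ be measurable. For parameters $\theta=(f,T,\zeta)$, with $f:\mathbb R^H\to\mathbb R^D$ measurable, $T_{i,j}:\mathbb R\to\mathbb R$ and $\zeta_{i,j}:\mathcal U\to\mathbb R$ ($1\le i\le H$, $1\le j\le K$), consider the identifiable-VAE model $$p_\theta(X,Z\mid U)=p_\varepsilon(X-f(Z))\,p_{T,\zeta}(Z\mid U),\qquad p_{T,\zeta}(Z\mid U)\propto\prod_{i=1}^H Q_i(Z_i)\exp\Big[\sum_{j=1}^K T_{i,j}(Z_i)\,\zeta_{i,j}(U)\Big],$$ where the prior is normalizable for every value of $U$. Let $\Omega$ be a set of such parameters, all of which satisfy: 1. the set of zeros of the characteristic function of $p_\varepsilon$ has Lebesgue measure zero in $\mathbb R^D$; 2. $f$ is injective; 3. every $T_{i,j}$ is differentiable almost everywhere, and for each $i$ the functions $T_{i,1},\dots,T_{i,K}$ are linearly independent on every measurable subset of $\mathbb R$ of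 positive Lebesgue measure; 4. there are $HK+1$ distinct points $U^0,\dots,U^{HK}\in\mathcal U$ (which may depend on $\theta$) such that the $HK\times HK$ matrix with columns $\boldsymbol\zeta(U^l)-\boldsymbol\zeta(U^0)$, $1\le l\le HK$, is invertible. For $O\subseteq\{1,\dots,D\}$ let $f_O:\mathbb R^H\to\mathbb R^{|O|}$ consist of the entries of $f$ with index in $O$. Assume that there is an integer $D_0\geq 0$ such that, for every $(f,T,\zeta)\in\Omega$, $f_O$ is injective for all $O$ with $|O|\ge D_0$. Then for every $O$ with $|O|\ge D_0$ the marginal model $p(X_O\mid U)$ is $\sim_A$-identifiable in $(f_O,T,\zeta)$: if $\theta,\tilde\theta\in\Omega$ satisfy $p_\theta(X_O\mid U=u)=p_{\tilde\theta}(X_O\mid U=u)$ for all $u\in\mathcal U$, then $(f_O,T,\zeta)\sim_A(\tilde f_O,\tilde T,\tilde\zeta)$. Here $\sim_A$ is the following equivalence relation. Write $\mathbf T(z)=(T_{i,j}(z_i))_{i,j}\in\mathbb R^{HK}$ and $\nu(dz)=\prod_i Q_i(z_i)\,dz$. Then $(g,T,\zeta)\sim_A(\tilde g,\tilde T,\tilde\zeta)$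 means that the image measures of $\nu$ under $g$ and $\tilde g$ have the same null sets, and that there are an invertible $HK\times HK$ matrix $\mathbf A$ and a vector $\mathbf c$ with $\mathbf T(g^{-1}(x))=\mathbf A\,\tilde{\mathbf T}(\tilde g^{-1}(x))+\mathbf c$ for almost every $x$ with respect to these image measures. -/

import Mathlib

open MeasureTheory ProbabilityTheory
open scoped NNReal ENNReal Matrix

noncomputable section

/-- The coordinates of `x ∈ ℝ^D` with index in `O`. -/
def restrictCoord {D : ℕ} (O : Finset (Fin D)) (x : EuclideanSpace ℝ (Fin D)) :
    EuclideanSpace ℝ O :=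
  WithLp.toLp 2 fun d : O => x d

/-- The parameters `(f, T, ζ)` of an identifiable VAE with latent space `ℝ^H`, `K` sufficient
statistics per latent coordinate, observed coordinates indexed by `ι`, and auxiliary variable
in `𝒰`. -/
structure VAEParam (H K : ℕ) (ι : Type*) (𝒰 : Type*) where
  f : (Fin H → ℝ) → EuclideanSpace ℝ ι
  T : Fin H → Fin K → ℝ → ℝ
  ζ : Fin H → Fin K → 𝒰 → ℝ

namespace VAEParam

variable {H K D : ℕ} {ι 𝒰 : Type*}

/-- `(f, T, ζ) ↦ (f_O, T, ζ)`. -/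
def restrict (O : Finset (Fin D)) (θ : VAEParam H K (Fin D) 𝒰) : VAEParam H K O 𝒰 where
  f := fun z => restrictCoord O (θ.f z)
  T := θ.T
  ζ := θ.ζ

/-- The stacked vector of sufficient statistics `𝐓(z) = (T_{i,j}(z_i))_{i,j}`. -/
def suffStat (θ : VAEParam H K ι 𝒰) (z : Fin H → ℝ) : Fin H × Fin K → ℝ :=
  fun p => θ.T p.1 p.2 (z p.1)

/-- `∏ i, Q_i(z_i) exp (∑ j, T_{i,j}(z_i) ζ_{i,j}(u))`. -/
def unnormPrior (Q : Fin H → ℝ → ℝ≥0) (θ : VAEParam H K ι 𝒰) (u : 𝒰) (z : Fin H → ℝ) : ℝ≥0∞ :=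
  ∏ i, (Q i (z i) : ℝ≥0∞) * ENNReal.ofReal (Real.exp (∑ j, θ.T i j (z i) * θ.ζ i j u))

/-- The normalizing constant of the prior. -/
def partitionFn (Q : Fin H → ℝ → ℝ≥0) (θ : VAEParam H K ι 𝒰) (u : 𝒰) : ℝ≥0∞ :=
  ∫⁻ z, unnormPrior Q θ u z

/-- The prior density `p_{T,ζ}(z | u)`. -/
def priorDensity (Q : Fin H → ℝ → ℝ≥0) (θ : VAEParam H K ι 𝒰) (u : 𝒰) (z : Fin H → ℝ) : ℝ≥0∞ :=
  unnormPrior Q θ u z / partitionFn Q θ u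

/-- The law of `(X, Z)` given `U = u`, with density `p_ε(x - f(z)) p_{T,ζ}(z | u)`. -/
def jointLaw (pε : EuclideanSpace ℝ (Fin D) → ℝ≥0) (Q : Fin H → ℝ → ℝ≥0)
    (θ : VAEParam H K (Fin D) 𝒰) (u : 𝒰) :
    Measure (EuclideanSpace ℝ (Fin D) × (Fin H → ℝ)) :=
  volume.withDensity fun p => (pε (p.1 - θ.f p.2) : ℝ≥0∞) * priorDensity Q θ u p.2

/-- The family `u ↦ p(X_O | U = u)` of marginal laws of the model. -/
def marginalLaw (pε : EuclideanSpace ℝ (Fin D) → ℝ≥0) (Q : Fin H → ℝ → ℝ≥0)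
    (O : Finset (Fin D)) (θ : VAEParam H K (Fin D) 𝒰) (u : 𝒰) : Measure (EuclideanSpace ℝ O) :=
  (jointLaw pε Q θ u).map fun p => restrictCoord O p.1

end VAEParam

/-- The law of the noise `ε` with density `p_ε`. -/
def noiseLaw {D : ℕ} (pε : EuclideanSpace ℝ (Fin D) → ℝ≥0) : Measure (EuclideanSpace ℝ (Fin D)) :=
  volume.withDensity fun e => (pε e : ℝ≥0∞)

/-- The base measure `∏ i, Q_i(z_i) dz_i` on the latent space. -/
def baseMeasure {H : ℕ} (Q : Fin H → ℝ → ℝ≥0) : Measure (Fin H → ℝ) :=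
  volume.withDensity fun z => ∏ i, (Q i (z i) : ℝ≥0∞)

/-- The conditions of the identifiability theorem for identifiable VAEs; `measurable_f`,
`partitionFn_ne_zero` and `partitionFn_ne_top` say that the densities of the model make sense. -/
structure IVAEConditions {H K D : ℕ} {𝒰 : Type*} (pε : EuclideanSpace ℝ (Fin D) → ℝ≥0)
    (Q : Fin H → ℝ → ℝ≥0) (θ : VAEParam H K (Fin D) 𝒰) : Prop where
  measurable_f : Measurable θ.f
  partitionFn_ne_zero : ∀ u, θ.partitionFn Q u ≠ 0
  partitionFn_ne_top : ∀ u, θ.partitionFn Q u ≠ ∞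
  charFun_noise : volume {t | charFun (noiseLaw pε) t = 0} = 0
  injective_f : Function.Injective θ.f
  ae_differentiable_T : ∀ i j, ∀ᵐ x : ℝ, DifferentiableAt ℝ (θ.T i j) x
  linearIndependent_T : ∀ i, ∀ S : Set ℝ, MeasurableSet S → 0 < volume S →
    LinearIndependent ℝ fun (j : Fin K) (x : S) => θ.T i j x
  /-- There are `HK + 1` distinct points: `u none` is the base point, the other ones are
  indexed by the `HK` pairs `(i, j)`. -/
  exists_points : ∃ u : Option (Fin H × Fin K) → 𝒰, Function.Injective u ∧
    IsUnit (Matrix.of fun p l : Fin H × Fin K =>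
      θ.ζ p.1 p.2 (u (some l)) - θ.ζ p.1 p.2 (u none))

/-- Every restriction `f_O` with `|O| ≥ D₀` is injective. -/
def InjectiveRestrictions {H D : ℕ} (D₀ : ℕ) (f : (Fin H → ℝ) → EuclideanSpace ℝ (Fin D)) : Prop :=
  ∀ O : Finset (Fin D), D₀ ≤ O.card → Function.Injective fun z => restrictCoord O (f z)

/-- The equivalence relation `∼_A`: the laws of `f(Z)` and `f'(Z)`, for `Z` distributed along the
base measure, have the same null sets, and `𝐓(f⁻¹(x)) = A 𝐓'(f'⁻¹(x)) + c` holds for almost every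
`x` with an invertible matrix `A` and a vector `c`. For measurable `f`, `f'` almost every `x` is in
the range of both, where `Function.invFun` is the inverse function if `f`, `f'` are injective. -/
def simA {H K : ℕ} {ι 𝒰 : Type*} (Q : Fin H → ℝ → ℝ≥0) : Setoid (VAEParam H K ι 𝒰) where
  r θ θ' :=
    (baseMeasure Q).map θ.f ≪ (baseMeasure Q).map θ'.f ∧
    (baseMeasure Q).map θ'.f ≪ (baseMeasure Q).map θ.f ∧
    ∃ (A : Matrix (Fin H × Fin K) (Fin H × Fin K) ℝ) (c : Fin H × Fin K → ℝ), IsUnit A ∧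
      ∀ᵐ x ∂(baseMeasure Q).map θ.f,
        θ.suffStat (Function.invFun θ.f x) = A *ᵥ θ'.suffStat (Function.invFun θ'.f x) + c
  iseqv :=
    { refl := fun θ => ⟨Measure.AbsolutelyContinuous.rfl, Measure.AbsolutelyContinuous.rfl, 1, 0,
        isUnit_one, Filter.Eventually.of_forall fun x => by simp⟩
      symm := by
        rintro θ θ' ⟨h1, h2, A, c, hA, h⟩
        have hd := (Matrix.isUnit_iff_isUnit_det A).1 hA
        refine ⟨h2, h1, A⁻¹, -(A⁻¹ *ᵥ c), A.isUnit_nonsing_inv_iff.2 hA, ?_⟩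
        filter_upwards [h2.ae_le h] with x hx
        rw [hx, Matrix.mulVec_add, Matrix.mulVec_mulVec, Matrix.nonsing_inv_mul _ hd,
          Matrix.one_mulVec, add_neg_cancel_right]
      trans := by
        rintro θ θ' θ'' ⟨h1, h2, A, c, hA, h⟩ ⟨k1, k2, B, d, hB, k⟩
        refine ⟨h1.trans k1, k2.trans h2, A * B, A *ᵥ d + c, hA.mul hB, ?_⟩
        filter_upwards [h, h1.ae_le k] with x hx kx
        rw [hx, kx, Matrix.mulVec_add, Matrix.mulVec_mulVec, add_assoc] }

/-- The model `p` is identifiable on the parameter space `Ω` up to the equivalence relation `s`. -/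
def IdentifiableUpTo {Θ P : Type*} (p : Θ → P) (Ω : Set Θ) (s : Setoid Θ) : Prop :=
  ∀ θ₁ ∈ Ω, ∀ θ₂ ∈ Ω, p θ₁ = p θ₂ → s θ₁ θ₂

end

/-! The law of X_O given U = u is the convolution of the law of ε_O with that of f_O(Z).
Independence factors the characteristic function of ε, so if its zeros form a null set, the same
holds for every subvector. Dividing it out (`eq_of_conv_eq_of_ae_charFun_ne_zero`) shows that both
models give f_O(Z) the same law for each u.

As f_O is injective, hence a measurable embedding, the density of this law at u relative to the one
at v is an exponential tilt read through the inverse of f_O, in which Q has cancelled. Logarithms at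
the HK + 1 points and the inverse of the matrix of ζ-differences make one model's statistics an
affine image of the other's (`VAEParam.exists_suffStat_eq_affine`), by a matrix that may be
singular.

Exchanging the models gives the reverse relation, so modulo a.e. constants both families of
statistics have the same span. Families of equal size with equal span, even dependent ones, differ
by an invertible matrix (`exists_isUnit_affine_of_affine`). -/

/-! ### Linear algebra: families with equal span -/

/-- Two families of `n` vectors with the same span are related by an invertible matrix. -/
theorem exists_isUnit_matrix_of_span_range_eq {n W : Type*} [Fintype n] [DecidableEq n]
    [AddCommGroup W] [Module ℝ W] (v v' : n → W)
    (h : Submodule.span ℝ (Set.range v) = Submodule.span ℝ (Set.range v')) :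
    ∃ A : Matrix n n ℝ, IsUnit A ∧ ∀ p, v p = ∑ q, A p q • v' q := by
  set S := Fintype.linearCombination ℝ v
  set S' := Fintype.linearCombination ℝ v'
  have hr : LinearMap.range S = LinearMap.range S' := by
    rw [Fintype.range_linearCombination, Fintype.range_linearCombination, h]
  have hk : Module.finrank ℝ (LinearMap.ker S) = Module.finrank ℝ (LinearMap.ker S') := by
    have h1 := S.finrank_range_add_finrank_ker
    have h2 := S'.finrank_range_add_finrank_ker
    rw [hr] at h1
    omega
  let j := LinearEquiv.ofFinrankEq _ _ hk
  obtain ⟨s, hs⟩ := S.rangeRestrict.exists_rightInverse_of_surjective S.range_rangeRestrict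
  obtain ⟨s', hs'⟩ := S'.rangeRestrict.exists_rightInverse_of_surjective S'.range_rangeRestrict
  have hs1 : ∀ a, S (s (S.rangeRestrict a)) = S a := fun a =>
    congrArg Subtype.val (LinearMap.congr_fun hs (S.rangeRestrict a))
  have hs2 : ∀ w, S' (s' w) = w := fun w => congrArg Subtype.val (LinearMap.congr_fun hs' w)
  -- The projection onto the kernel of `S` along the range of the section `s`.
  let π : (n → ℝ) →ₗ[ℝ] LinearMap.ker S :=
    (LinearMap.id - s ∘ₗ S.rangeRestrict).codRestrict _ fun a => by
      simp only [LinearMap.mem_ker, LinearMap.sub_apply, map_sub, LinearMap.comp_apply, hs1,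
        LinearMap.id_apply, sub_self]
  -- Lift the common range through `s'` and match the kernels, of equal dimension by rank-nullity,
  -- through `j`. This gives an automorphism with `S' ∘ e = S`.
  let e : (n → ℝ) →ₗ[ℝ] (n → ℝ) :=
    s' ∘ₗ (LinearEquiv.ofEq _ _ hr).toLinearMap ∘ₗ S.rangeRestrict +
      (LinearMap.ker S').subtype ∘ₗ j.toLinearMap ∘ₗ π
  have hSe : ∀ a, S' (e a) = S a := fun a => by
    have h1 : S' ((j (π a) : LinearMap.ker S') : n → ℝ) = 0 := (j (π a)).2
    have h2 := hs2 (LinearEquiv.ofEq _ _ hr (S.rangeRestrict a))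
    simp only [e, LinearMap.add_apply, map_add, LinearMap.comp_apply, LinearEquiv.coe_coe,
      Submodule.subtype_apply]
    rw [h1, h2, add_zero]
    rfl
  have he : Function.Injective e := by
    rw [← LinearMap.ker_eq_bot, LinearMap.ker_eq_bot']
    intro a ha
    have h0 : S.rangeRestrict a = 0 := Subtype.ext (by
      have := hSe a
      rw [ha, map_zero] at this
      exact this.symm)
    have h1 : j (π a) = 0 := Subtype.ext (by simpa [e, h0] using ha)
    have h2 : π a = 0 := by simpa using h1
    have h3 := congrArg Subtype.val h2
    simpa [π, h0] using h3
  -- Transposed because the coefficients of `v p` are the entries of `e (Pi.single p 1)`, a column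
  -- of the matrix of `e`.
  refine ⟨(LinearMap.toMatrix' e)ᵀ, ?_, fun p => ?_⟩
  · rw [Matrix.isUnit_transpose, LinearMap.isUnit_toMatrix'_iff]
    exact (Module.End.isUnit_iff e).2 ⟨he, LinearMap.injective_iff_surjective.1 he⟩
  · have := hSe (Pi.single p 1)
    rw [Fintype.linearCombination_apply_single, one_smul] at this
    rw [← this, Fintype.linearCombination_apply]
    simp [LinearMap.toMatrix'_apply]

/-! ### Measure-theoretic preliminaries -/

/-- A function differentiable at almost every real is almost everywhere measurable. -/
theorem aemeasurable_of_ae_differentiableAt {g : ℝ → ℝ}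
    (h : ∀ᵐ x : ℝ, DifferentiableAt ℝ g x) : AEMeasurable g := by
  obtain ⟨s, hs, hm, h0⟩ := exists_measurable_superset_of_null (ae_iff.1 h)
  have hc : ContinuousOn g sᶜ := fun x hx =>
    (not_not.1 fun hn => hx (hs hn) : DifferentiableAt ℝ g x).continuousAt.continuousWithinAt
  have := hc.aemeasurable (μ := volume) hm.compl
  have hs' : ∀ᵐ x : ℝ, x ∈ sᶜ := compl_mem_ae_iff.2 h0
  rwa [Measure.restrict_eq_self_of_ae_mem hs'] at this

theorem MeasurableEmbedding.map_withDensity_comp {α β : Type*} [MeasurableSpace α]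
    [MeasurableSpace β] {f : α → β} (hf : MeasurableEmbedding f) (μ : Measure α) (g : β → ℝ≥0∞) :
    (μ.withDensity (g ∘ f)).map f = (μ.map f).withDensity g := by
  ext s hs
  rw [hf.map_apply, withDensity_apply _ hs, withDensity_apply _ (hf.measurable hs),
    hf.restrict_map, hf.lintegral_map]
  rfl

/-- Translating the first coordinate by a function of the second one preserves the product with a
translation invariant measure. -/
theorem measurePreserving_prod_add_comp {E Z : Type*} [MeasurableSpace E] [MeasurableSpace Z]
    [AddGroup E] [MeasurableAdd₂ E] (μ : Measure E) [μ.IsAddRightInvariant] [SFinite μ]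
    (ν : Measure Z) [SFinite ν] {f : Z → E} (hf : Measurable f) :
    MeasurePreserving (fun p : E × Z => (p.1 + f p.2, p.2)) (μ.prod ν) (μ.prod ν) := by
  have := (MeasurePreserving.id ν).skew_product (μc := μ) (μd := μ) (g := fun z x => x + f z)
    (by simp only [Function.uncurry_def]; fun_prop)
    (Filter.Eventually.of_forall fun z => map_add_right_eq_self μ (f z))
  exact Measure.measurePreserving_swap.comp (this.comp Measure.measurePreserving_swap)

/-! ### Noise subvectors and deconvolution -/

theorem measurable_restrictCoord {D : ℕ} (O : Finset (Fin D)) :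
    Measurable (restrictCoord O) := by
  unfold restrictCoord
  fun_prop

/-- If the coordinate cylinder over `S` is Lebesgue null, so is `S`. -/
theorem volume_eq_zero_of_volume_coord_preimage {D : ℕ} (d : Fin D) {S : Set ℝ}
    (h : volume {x : EuclideanSpace ℝ (Fin D) | x d ∈ S} = 0) : volume S = 0 := by
  have h1 : volume {x : Fin D → ℝ | x d ∈ S} = 0 := by
    rw [← (PiLp.volume_preserving_toLp (Fin D)).measure_preimage_emb
      (MeasurableEquiv.toLp 2 (Fin D → ℝ)).measurableEmbedding] at h
    exact h
  have h2 : {x : Fin D → ℝ | x d ∈ S} =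
      Set.univ.pi (Function.update (fun _ => Set.univ) d S) := by
    ext x
    simp only [Set.mem_ofPred_eq, Set.mem_univ_pi]
    refine ⟨fun hx i => ?_, fun hx => by simpa using hx d⟩
    rcases eq_or_ne i d with rfl | hi
    · simpa using hx
    · simp [hi]
  rw [h2, volume_pi, Measure.pi_pi, Finset.prod_eq_zero_iff] at h1
  obtain ⟨i, -, hi⟩ := h1
  -- The vanishing factor must be the one at `d`: all others are the measure of the whole line.
  rcases eq_or_ne i d with rfl | hne
  · simpa using hi
  · simp [hne] at hi

/-- For noise with independent coordinates and an almost everywhere nonzero characteristic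
function, every subvector of the noise has an almost everywhere nonzero characteristic function. -/
theorem ae_charFun_map_restrictCoord_ne_zero {D : ℕ} (μ : Measure (EuclideanSpace ℝ (Fin D)))
    [IsProbabilityMeasure μ]
    (hindep : iIndepFun (fun (d : Fin D) (e : EuclideanSpace ℝ (Fin D)) => e d) μ)
    (h0 : volume {t | charFun μ t = 0} = 0) (O : Finset (Fin D)) :
    ∀ᵐ t, charFun (μ.map (restrictCoord O)) t ≠ 0 := by
  have h1 : ∀ t, charFun μ t = ∏ d, charFun (μ.map fun e => e d) (t d) := by
    have := (iIndepFun_iff_charFun_pi (fun d => by fun_prop)).1 hindep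
    simpa using this
  have h2 : ∀ t, charFun (μ.map (restrictCoord O)) t =
      ∏ d : O, charFun (μ.map fun e => e d) (t d) :=
    (iIndepFun_iff_charFun_pi (fun d => by fun_prop)).1
      (hindep.precomp (g := ((↑) : O → Fin D)) Subtype.val_injective)
  have h3 : ∀ d : Fin D, ∀ᵐ s : ℝ, charFun (μ.map fun e => e d) s ≠ 0 := fun d => by
    rw [ae_iff]
    -- A zero of one factor kills the whole product, so the cylinder over the zeros of that factor
    -- lies in the null zero set.
    refine volume_eq_zero_of_volume_coord_preimage d (measure_mono_null (fun t ht => ?_) h0)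
    rw [Set.mem_ofPred_eq, h1]
    exact Finset.prod_eq_zero (Finset.mem_univ d) (not_not.1 ht)
  have h4 : ∀ d : O, ∀ᵐ t : EuclideanSpace ℝ O, charFun (μ.map fun e => e d) (t d) ≠ 0 := fun d =>
    ((Measure.quasiMeasurePreserving_eval (fun _ : O => (volume : Measure ℝ)) d).comp
      (PiLp.volume_preserving_ofLp O).quasiMeasurePreserving).ae (h3 d)
  filter_upwards [ae_all_iff.2 h4] with t ht
  rw [h2]
  exact Finset.prod_ne_zero_iff.2 fun d _ => ht d

/-- Deconvolution by noise whose characteristic function is almost everywhere nonzero. -/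
theorem eq_of_conv_eq_of_ae_charFun_ne_zero {E : Type*} [NormedAddCommGroup E]
    [InnerProductSpace ℝ E] [FiniteDimensional ℝ E] [MeasurableSpace E] [BorelSpace E]
    {ρ μ ν : Measure E} [IsFiniteMeasure ρ] [IsFiniteMeasure μ] [IsFiniteMeasure ν]
    (hρ : ∀ᵐ t, charFun ρ t ≠ 0) (h : ρ ∗ μ = ρ ∗ ν) : μ = ν := by
  refine Measure.ext_of_charFun ?_
  -- Lebesgue measure charges open sets, so a.e. equality of continuous functions is equality.
  refine (Continuous.ae_eq_iff_eq (volume : Measure E) continuous_charFun continuous_charFun).1 ?_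
  filter_upwards [hρ] with t ht
  have := congrArg (fun m => charFun m t) h
  simp only [charFun_conv] at this
  exact mul_left_cancel₀ ht this

/-! ### Prior laws as exponential tilts, and the convolution formula -/

namespace VAEParam

variable {H K D : ℕ} {ι 𝒰 : Type*}

/-- The prior law of `Z` given `U = u`. -/
noncomputable def priorLaw (Q : Fin H → ℝ → ℝ≥0) (θ : VAEParam H K ι 𝒰) (u : 𝒰) :
    Measure (Fin H → ℝ) :=
  volume.withDensity (priorDensity Q θ u)

/-- The exponent `∑ T_{i,j}(z_i) ζ_{i,j}(u)` of the prior. -/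
def exponent (θ : VAEParam H K ι 𝒰) (u : 𝒰) (z : Fin H → ℝ) : ℝ :=
  ∑ p : Fin H × Fin K, θ.suffStat z p * θ.ζ p.1 p.2 u

theorem unnormPrior_eq (Q : Fin H → ℝ → ℝ≥0) (θ : VAEParam H K ι 𝒰) (u : 𝒰) (z : Fin H → ℝ) :
    θ.unnormPrior Q u z =
      (∏ i, (Q i (z i) : ℝ≥0∞)) * ENNReal.ofReal (Real.exp (θ.exponent u z)) := by
  rw [unnormPrior, Finset.prod_mul_distrib, exponent, Fintype.sum_prod_type, Real.exp_sum,
    ENNReal.ofReal_prod_of_nonneg fun i _ => (Real.exp_pos _).le]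
  rfl

theorem aemeasurable_exponent {θ : VAEParam H K ι 𝒰} (hT : ∀ i j, AEMeasurable (θ.T i j)) (u : 𝒰) :
    AEMeasurable (θ.exponent u) :=
  Finset.aemeasurable_fun_sum _ fun p _ => ((hT p.1 p.2).comp_quasiMeasurePreserving
    (Measure.quasiMeasurePreserving_eval (fun _ : Fin H => (volume : Measure ℝ)) p.1)).mul_const _

theorem aemeasurable_exp_exponent {θ : VAEParam H K ι 𝒰} (hT : ∀ i j, AEMeasurable (θ.T i j))
    (u : 𝒰) : AEMeasurable fun z => ENNReal.ofReal (Real.exp (θ.exponent u z)) :=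
  (Real.measurable_exp.comp_aemeasurable (aemeasurable_exponent hT u)).ennreal_ofReal

theorem measurable_prod_density {Q : Fin H → ℝ → ℝ≥0} (hQ : ∀ i, Measurable (Q i)) :
    Measurable fun z : Fin H → ℝ => ∏ i, (Q i (z i) : ℝ≥0∞) :=
  Finset.measurable_fun_prod _ fun i _ => ((hQ i).comp (measurable_pi_apply i)).coe_nnreal_ennreal

theorem aemeasurable_priorDensity {Q : Fin H → ℝ → ℝ≥0} (hQ : ∀ i, Measurable (Q i))
    {θ : VAEParam H K ι 𝒰} (hT : ∀ i j, AEMeasurable (θ.T i j)) (u : 𝒰) :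
    AEMeasurable (priorDensity Q θ u) := by
  unfold priorDensity
  simp only [unnormPrior_eq]
  exact ((measurable_prod_density hQ).aemeasurable.mul (aemeasurable_exp_exponent hT u)).div_const _

theorem isProbabilityMeasure_priorLaw {Q : Fin H → ℝ → ℝ≥0} {θ : VAEParam H K ι 𝒰} {u : 𝒰}
    (h0 : θ.partitionFn Q u ≠ 0) (htop : θ.partitionFn Q u ≠ ∞) :
    IsProbabilityMeasure (priorLaw Q θ u) where
  measure_univ := by
    rw [priorLaw, withDensity_apply _ MeasurableSet.univ, Measure.restrict_univ]
    simp only [priorDensity, div_eq_mul_inv]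
    rw [lintegral_mul_const' _ _ (ENNReal.inv_ne_top.2 h0)]
    exact ENNReal.mul_inv_cancel h0 htop

/-- The prior has a strictly positive density relative to the base measure, so null sets can be
moved between them whatever the value of u. -/
theorem priorLaw_absolutelyContinuous {Q : Fin H → ℝ → ℝ≥0} (hQ : ∀ i, Measurable (Q i))
    {θ : VAEParam H K ι 𝒰} (hT : ∀ i j, AEMeasurable (θ.T i j)) {u : 𝒰}
    (htop : θ.partitionFn Q u ≠ ∞) :
    priorLaw Q θ u ≪ baseMeasure Q ∧ baseMeasure Q ≪ priorLaw Q θ u := by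
  let g : (Fin H → ℝ) → ℝ≥0∞ :=
    fun z => ENNReal.ofReal (Real.exp (θ.exponent u z)) / θ.partitionFn Q u
  have hg : AEMeasurable g := (aemeasurable_exp_exponent hT u).div_const _
  have hp : priorDensity Q θ u = (fun z => ∏ i, (Q i (z i) : ℝ≥0∞)) * g := by
    funext z
    rw [priorDensity, unnormPrior_eq, mul_div_assoc, Pi.mul_apply]
  have hd : priorLaw Q θ u = (baseMeasure Q).withDensity g := by
    rw [priorLaw, hp, withDensity_mul₀ (measurable_prod_density hQ).aemeasurable hg, baseMeasure]
  rw [hd]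
  refine ⟨withDensity_absolutelyContinuous _ _, withDensity_absolutelyContinuous'
    (hg.mono_ac (withDensity_absolutelyContinuous _ _)) (Filter.Eventually.of_forall fun z => ?_)⟩
  exact ENNReal.div_ne_zero.2 ⟨(ENNReal.ofReal_pos.2 (Real.exp_pos _)).ne', htop⟩

/-- Prior laws for different values of the auxiliary variable differ by exponential tilting. -/
theorem exists_priorLaw_eq_withDensity {Q : Fin H → ℝ → ℝ≥0} (hQ : ∀ i, Measurable (Q i))
    {θ : VAEParam H K ι 𝒰} (hT : ∀ i j, AEMeasurable (θ.T i j))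
    (h0 : ∀ u, θ.partitionFn Q u ≠ 0) (htop : ∀ u, θ.partitionFn Q u ≠ ∞) (u v : 𝒰) :
    ∃ k : ℝ, priorLaw Q θ u = (priorLaw Q θ v).withDensity fun z =>
      ENNReal.ofReal (Real.exp (θ.exponent u z - θ.exponent v z + k)) := by
  have hu := aemeasurable_exponent hT u
  have hv := aemeasurable_exponent hT v
  -- The ratio of the normalizing constants, moved into the exponent.
  refine ⟨Real.log ((θ.partitionFn Q v).toReal / (θ.partitionFn Q u).toReal), ?_⟩
  have hZu := ENNReal.toReal_pos (h0 u) (htop u)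
  have hZv := ENNReal.toReal_pos (h0 v) (htop v)
  rw [priorLaw, priorLaw, ← withDensity_mul₀ (aemeasurable_priorDensity hQ hT v) (by fun_prop)]
  congr 1
  ext z
  simp only [priorDensity, unnormPrior_eq, Pi.mul_apply]
  rw [← ENNReal.ofReal_toReal (htop u), ← ENNReal.ofReal_toReal (htop v),
    mul_div_assoc, mul_div_assoc, mul_assoc, ← ENNReal.ofReal_div_of_pos hZu,
    ← ENNReal.ofReal_div_of_pos hZv, ← ENNReal.ofReal_mul (by positivity), Real.exp_add,
    Real.exp_log (by
      simp only [ENNReal.toReal_ofReal hZu.le, ENNReal.toReal_ofReal hZv.le]; positivity),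
    Real.exp_sub]
  congr 2
  simp only [ENNReal.toReal_ofReal hZu.le, ENNReal.toReal_ofReal hZv.le]
  have := (Real.exp_pos (θ.exponent v z)).ne'
  field_simp

/-- The marginal model is the convolution of the laws of `ε_O` and `f_O(Z)`. -/
theorem marginalLaw_eq_conv {pε : EuclideanSpace ℝ (Fin D) → ℝ≥0} (hpε : Measurable pε)
    {Q : Fin H → ℝ → ℝ≥0} (hQ : ∀ i, Measurable (Q i)) (O : Finset (Fin D))
    {θ : VAEParam H K (Fin D) 𝒰} (hf : Measurable θ.f) (hT : ∀ i j, AEMeasurable (θ.T i j)) (u : 𝒰)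
    [SFinite (priorLaw Q θ u)] :
    marginalLaw pε Q O θ u = (noiseLaw pε).map (restrictCoord O) ∗
      (priorLaw Q θ u).map fun z => restrictCoord O (θ.f z) := by
  have hd := aemeasurable_priorDensity hQ hT u
  have hO := measurable_restrictCoord O
  have : SFinite (noiseLaw pε) := inferInstanceAs (SFinite (volume.withDensity _))
  -- The shear (e, z) ↦ (e + f(z), z) turns independent noise and latent into (X, Z) and preserves
  -- volume.
  set Φ : EuclideanSpace ℝ (Fin D) × (Fin H → ℝ) → EuclideanSpace ℝ (Fin D) × (Fin H → ℝ) :=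
    fun p => (p.1 + θ.f p.2, p.2)
  have hΦ : MeasurePreserving Φ volume volume := measurePreserving_prod_add_comp volume volume hf
  have hinj : Function.Injective Φ := by
    rintro ⟨x, z⟩ ⟨x', z'⟩ h
    obtain ⟨h1, rfl⟩ := Prod.mk.inj h
    exact Prod.ext (add_right_cancel h1) rfl
  have hj : jointLaw pε Q θ u = ((noiseLaw pε).prod (priorLaw Q θ u)).map Φ := by
    rw [jointLaw, noiseLaw, priorLaw, prod_withDensity₀ (by fun_prop) hd]
    nth_rw 1 [← hΦ.map_eq]
    rw [← (hΦ.measurable.measurableEmbedding hinj).map_withDensity_comp]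
    congr 2
    ext p
    simp [Φ]
  rw [marginalLaw, hj, Measure.map_map (by fun_prop) hΦ.measurable, Measure.conv,
    Measure.map_prod_map _ _ (by fun_prop) (by fun_prop), Measure.map_map (by fun_prop) (by fun_prop)]
  rfl

end VAEParam

/-! ### Affine relations modulo a.e. constants -/

/-- The functions that are almost everywhere constant. -/
def aeConst {X : Type*} [MeasurableSpace X] (μ : Measure X) : Submodule ℝ (X → ℝ) where
  carrier := {h | ∃ k : ℝ, ∀ᵐ x ∂μ, h x = k}
  add_mem' := by
    rintro a b ⟨k, hk⟩ ⟨l, hl⟩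
    refine ⟨k + l, ?_⟩
    filter_upwards [hk, hl] with x h1 h2
    rw [Pi.add_apply, h1, h2]
  zero_mem' := ⟨0, Filter.Eventually.of_forall fun _ => rfl⟩
  smul_mem' := by
    rintro r a ⟨k, hk⟩
    refine ⟨r * k, ?_⟩
    filter_upwards [hk] with x h1
    rw [Pi.smul_apply, h1, smul_eq_mul]

/-- Passing to the quotient kills the shift c, so the affine relation becomes a linear one. -/
theorem span_mkQ_aeConst_le {X n : Type*} [MeasurableSpace X] [Fintype n] {μ : Measure X}
    {t t' : X → n → ℝ} {A : Matrix n n ℝ} {c : n → ℝ} (h : ∀ᵐ x ∂μ, t x = A *ᵥ t' x + c) :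
    Submodule.span ℝ (Set.range fun p => (aeConst μ).mkQ fun x => t x p) ≤
      Submodule.span ℝ (Set.range fun p => (aeConst μ).mkQ fun x => t' x p) := by
  rw [Submodule.span_le]
  rintro _ ⟨p, rfl⟩
  have : (aeConst μ).mkQ (fun x => t x p) =
      ∑ q, A p q • (aeConst μ).mkQ fun x => t' x q := by
    simp_rw [← map_smul, ← map_sum]
    rw [Submodule.mkQ_apply, Submodule.mkQ_apply, Submodule.Quotient.eq]
    refine ⟨c p, ?_⟩
    filter_upwards [h] with x hx
    simp [hx, Matrix.mulVec, dotProduct]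
  rw [SetLike.mem_coe]
  beta_reduce
  rw [this]
  exact Submodule.sum_mem _ fun q _ => Submodule.smul_mem _ _ (Submodule.subset_span ⟨q, rfl⟩)

/-- Two vector-valued functions that are almost everywhere affine images of each other are
related by an invertible affine map. -/
theorem exists_isUnit_affine_of_affine {X n : Type*} [MeasurableSpace X] [Fintype n]
    [DecidableEq n] {μ : Measure X} {t t' : X → n → ℝ}
    (h : ∃ (A : Matrix n n ℝ) (c : n → ℝ), ∀ᵐ x ∂μ, t x = A *ᵥ t' x + c)
    (h' : ∃ (A : Matrix n n ℝ) (c : n → ℝ), ∀ᵐ x ∂μ, t' x = A *ᵥ t x + c) :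
    ∃ (A : Matrix n n ℝ) (c : n → ℝ), IsUnit A ∧ ∀ᵐ x ∂μ, t x = A *ᵥ t' x + c := by
  obtain ⟨_, _, h⟩ := h
  obtain ⟨_, _, h'⟩ := h'
  obtain ⟨A, hA, hv⟩ := exists_isUnit_matrix_of_span_range_eq _ _
    (le_antisymm (span_mkQ_aeConst_le h) (span_mkQ_aeConst_le h'))
  have hc : ∀ p, ∃ k : ℝ, ∀ᵐ x ∂μ, t x p - (A *ᵥ t' x) p = k := fun p => by
    have hp := hv p
    simp_rw [← map_smul, ← map_sum] at hp
    rw [Submodule.mkQ_apply, Submodule.mkQ_apply, Submodule.Quotient.eq] at hp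
    obtain ⟨k, hk⟩ := hp
    refine ⟨k, ?_⟩
    filter_upwards [hk] with x hx
    simpa [Matrix.mulVec, dotProduct] using hx
  choose c hc using hc
  refine ⟨A, c, hA, ?_⟩
  filter_upwards [ae_all_iff.2 hc] with x hx
  ext p
  rw [Pi.add_apply, ← hx p]
  ring

/-! ### From equal laws to affinely related statistics -/

namespace VAEParam

variable {H K : ℕ} {ι 𝒰 : Type*} [Fintype ι]

/-- If `f(Z)` and `f'(Z)` have the same conditional laws, the exponents of the two priors agree on
the observation space up to additive constants. -/
theorem exists_exponent_sub_eq {Q : Fin H → ℝ → ℝ≥0} (hQ : ∀ i, Measurable (Q i))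
    {θ θ' : VAEParam H K ι 𝒰} (hT : ∀ i j, AEMeasurable (θ.T i j))
    (hT' : ∀ i j, AEMeasurable (θ'.T i j))
    (h0 : ∀ u, θ.partitionFn Q u ≠ 0) (htop : ∀ u, θ.partitionFn Q u ≠ ∞)
    (h0' : ∀ u, θ'.partitionFn Q u ≠ 0) (htop' : ∀ u, θ'.partitionFn Q u ≠ ∞)
    (hf : MeasurableEmbedding θ.f) (hf' : MeasurableEmbedding θ'.f)
    (heq : ∀ u, (priorLaw Q θ u).map θ.f = (priorLaw Q θ' u).map θ'.f) (u v : 𝒰) :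
    ∃ k : ℝ, ∀ᵐ x ∂(baseMeasure Q).map θ.f,
      θ.exponent u (Function.invFun θ.f x) - θ.exponent v (Function.invFun θ.f x) =
        θ'.exponent u (Function.invFun θ'.f x) - θ'.exponent v (Function.invFun θ'.f x) + k := by
  have tilt : ∀ φ : VAEParam H K ι 𝒰, (∀ i j, AEMeasurable (φ.T i j)) →
      (∀ u, φ.partitionFn Q u ≠ 0) → (∀ u, φ.partitionFn Q u ≠ ∞) → MeasurableEmbedding φ.f →
      ∃ (k : ℝ) (g : EuclideanSpace ℝ ι → ℝ≥0∞),
        (g = fun x => ENNReal.ofReal (Real.exp (φ.exponent u (Function.invFun φ.f x) -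
          φ.exponent v (Function.invFun φ.f x) + k))) ∧
        AEMeasurable g ((priorLaw Q φ v).map φ.f) ∧
        (priorLaw Q φ u).map φ.f = ((priorLaw Q φ v).map φ.f).withDensity g := by
    intro φ hT h0 htop hf
    obtain ⟨k, hk⟩ := exists_priorLaw_eq_withDensity hQ hT h0 htop u v
    have hcomp : (fun x => ENNReal.ofReal (Real.exp (φ.exponent u (Function.invFun φ.f x) -
          φ.exponent v (Function.invFun φ.f x) + k))) ∘ φ.f =
        fun z => ENNReal.ofReal (Real.exp (φ.exponent u z - φ.exponent v z + k)) := by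
      funext z
      simp only [Function.comp_apply, Function.leftInverse_invFun hf.injective z]
    refine ⟨k, _, rfl, ?_, ?_⟩
    -- Measurability is checked on the latent space, where the inverse function cancels.
    · rw [hf.aemeasurable_map_iff, hcomp]
      exact (Real.measurable_exp.comp_aemeasurable (((aemeasurable_exponent hT u).sub
        (aemeasurable_exponent hT v)).add_const k)).ennreal_ofReal.mono_ac
          (withDensity_absolutelyContinuous _ _)
    · rw [← hf.map_withDensity_comp, hcomp, ← hk]
  obtain ⟨k, g, hg, hgm, hgd⟩ := tilt θ hT h0 htop hf
  obtain ⟨k', g', hg', hgm', hgd'⟩ := tilt θ' hT' h0' htop' hf'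
  have := isProbabilityMeasure_priorLaw (h0 v) (htop v)
  have := Measure.isProbabilityMeasure_map (μ := priorLaw Q θ v) hf.measurable.aemeasurable
  rw [← heq v] at hgm' hgd'
  rw [← heq u, hgd] at hgd'
  -- Both tilts are now densities of one law relative to the same probability measure, hence agree
  -- a.e.
  have hae := (withDensity_eq_iff_of_sigmaFinite hgm hgm').1 hgd'
  refine ⟨k' - k, ?_⟩
  filter_upwards [((priorLaw_absolutelyContinuous hQ hT (htop v)).2.map hf.measurable).ae_le hae]
    with x hx
  rw [hg, hg', ENNReal.ofReal_eq_ofReal_iff (Real.exp_pos _).le (Real.exp_pos _).le,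
    Real.exp_eq_exp] at hx
  linarith

/-- If `f(Z)` and `f'(Z)` have the same conditional laws and `ζ` varies sufficiently, the sufficient
statistics of the first model are affine images of those of the second one. -/
theorem exists_suffStat_eq_affine {Q : Fin H → ℝ → ℝ≥0} (hQ : ∀ i, Measurable (Q i))
    {θ θ' : VAEParam H K ι 𝒰} (hT : ∀ i j, AEMeasurable (θ.T i j))
    (hT' : ∀ i j, AEMeasurable (θ'.T i j))
    (h0 : ∀ u, θ.partitionFn Q u ≠ 0) (htop : ∀ u, θ.partitionFn Q u ≠ ∞)
    (h0' : ∀ u, θ'.partitionFn Q u ≠ 0) (htop' : ∀ u, θ'.partitionFn Q u ≠ ∞)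
    (hf : MeasurableEmbedding θ.f) (hf' : MeasurableEmbedding θ'.f)
    (heq : ∀ u, (priorLaw Q θ u).map θ.f = (priorLaw Q θ' u).map θ'.f)
    {u : Option (Fin H × Fin K) → 𝒰}
    (hu : IsUnit (Matrix.of fun p l : Fin H × Fin K =>
      θ.ζ p.1 p.2 (u (some l)) - θ.ζ p.1 p.2 (u none))) :
    ∃ (A : Matrix (Fin H × Fin K) (Fin H × Fin K) ℝ) (c : Fin H × Fin K → ℝ),
      ∀ᵐ x ∂(baseMeasure Q).map θ.f,
        θ.suffStat (Function.invFun θ.f x) = A *ᵥ θ'.suffStat (Function.invFun θ'.f x) + c := by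
  let N (φ : VAEParam H K ι 𝒰) : Matrix (Fin H × Fin K) (Fin H × Fin K) ℝ :=
    Matrix.of fun p l => φ.ζ p.1 p.2 (u (some l)) - φ.ζ p.1 p.2 (u none)
  have hN : ∀ (φ : VAEParam H K ι 𝒰) z l,
      ((N φ)ᵀ *ᵥ φ.suffStat z) l = φ.exponent (u (some l)) z - φ.exponent (u none) z := by
    intro φ z l
    simp only [Matrix.mulVec, dotProduct, Matrix.transpose_apply, N, Matrix.of_apply, exponent,
      ← Finset.sum_sub_distrib]
    exact Finset.sum_congr rfl fun p _ => by ring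
  choose k hk using fun l => exists_exponent_sub_eq hQ hT hT' h0 htop h0' htop' hf hf' heq
    (u (some l)) (u none)
  have hdet : IsUnit (N θ)ᵀ.det := by
    rw [Matrix.det_transpose]
    exact (Matrix.isUnit_iff_isUnit_det _).1 hu
  -- Only `N θ` is inverted; nothing is asked of `N θ'`, evaluated at points chosen for `θ`.
  refine ⟨(N θ)ᵀ⁻¹ * (N θ')ᵀ, (N θ)ᵀ⁻¹ *ᵥ k, ?_⟩
  filter_upwards [ae_all_iff.2 hk] with x hx
  have hx' : (N θ)ᵀ *ᵥ θ.suffStat (Function.invFun θ.f x) =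
      (N θ')ᵀ *ᵥ θ'.suffStat (Function.invFun θ'.f x) + k := by
    ext l
    rw [Pi.add_apply, hN, hN, hx]
  rw [← Matrix.mulVec_mulVec, ← Matrix.mulVec_add, ← hx', Matrix.mulVec_mulVec,
    Matrix.nonsing_inv_mul _ hdet, Matrix.one_mulVec]

end VAEParam

/-! ### Identifiability of the marginal model -/

theorem corollary1 {H K D : ℕ} {𝒰 : Type*}
    (pε : EuclideanSpace ℝ (Fin D) → ℝ≥0) (hpε : Measurable pε)
    (hpε_one : ∫⁻ e, (pε e : ℝ≥0∞) = 1)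
    (hindep : iIndepFun (fun (d : Fin D) (e : EuclideanSpace ℝ (Fin D)) => e d) (noiseLaw pε))
    (Q : Fin H → ℝ → ℝ≥0) (hQ : ∀ i, Measurable (Q i))
    (Ω : Set (VAEParam H K (Fin D) 𝒰)) (hΩ : ∀ θ ∈ Ω, IVAEConditions pε Q θ)
    (D₀ : ℕ) (hD₀ : ∀ θ ∈ Ω, InjectiveRestrictions D₀ θ.f)
    (O : Finset (Fin D)) (hO : D₀ ≤ O.card) :
    IdentifiableUpTo (VAEParam.marginalLaw pε Q O) Ω
      (Setoid.comap (VAEParam.restrict O) (simA Q)) := by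
  intro θ hθ θ' hθ' hp
  have c := hΩ θ hθ
  have c' := hΩ θ' hθ'
  have hT i j := aemeasurable_of_ae_differentiableAt (c.ae_differentiable_T i j)
  have hT' i j := aemeasurable_of_ae_differentiableAt (c'.ae_differentiable_T i j)
  have hf : MeasurableEmbedding (θ.restrict O).f :=
    ((measurable_restrictCoord O).comp c.measurable_f).measurableEmbedding (hD₀ θ hθ O hO)
  have hf' : MeasurableEmbedding (θ'.restrict O).f :=
    ((measurable_restrictCoord O).comp c'.measurable_f).measurableEmbedding (hD₀ θ' hθ' O hO)
  have : IsProbabilityMeasure (noiseLaw pε) :=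
    ⟨by rw [noiseLaw, withDensity_apply _ MeasurableSet.univ, Measure.restrict_univ, hpε_one]⟩
  have hne := ae_charFun_map_restrictCoord_ne_zero _ hindep c.charFun_noise O
  have heq : ∀ u, ((θ.restrict O).priorLaw Q u).map (θ.restrict O).f =
      ((θ'.restrict O).priorLaw Q u).map (θ'.restrict O).f := fun u => by
    have h := congrFun hp u
    have hP : IsProbabilityMeasure (θ.priorLaw Q u) :=
      VAEParam.isProbabilityMeasure_priorLaw (c.partitionFn_ne_zero u) (c.partitionFn_ne_top u)
    have hP' : IsProbabilityMeasure (θ'.priorLaw Q u) :=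
      VAEParam.isProbabilityMeasure_priorLaw (c'.partitionFn_ne_zero u) (c'.partitionFn_ne_top u)
    rw [VAEParam.marginalLaw_eq_conv hpε hQ O c.measurable_f hT,
      VAEParam.marginalLaw_eq_conv hpε hQ O c'.measurable_f hT'] at h
    -- The prior does not involve f, so restricting to O leaves it unchanged by definition.
    change IsProbabilityMeasure ((θ.restrict O).priorLaw Q u) at hP
    change IsProbabilityMeasure ((θ'.restrict O).priorLaw Q u) at hP'
    exact eq_of_conv_eq_of_ae_charFun_ne_zero hne h
  obtain ⟨u, -, hu⟩ := c.exists_points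
  obtain ⟨u', -, hu'⟩ := c'.exists_points
  -- Any value of the auxiliary variable serves here; `u none` is one at hand.
  have h1 := VAEParam.priorLaw_absolutelyContinuous (θ := θ.restrict O) hQ hT
    (c.partitionFn_ne_top (u none))
  have h2 := VAEParam.priorLaw_absolutelyContinuous (θ := θ'.restrict O) hQ hT'
    (c'.partitionFn_ne_top (u none))
  have hac : (baseMeasure Q).map (θ.restrict O).f ≪ (baseMeasure Q).map (θ'.restrict O).f := by
    refine (h1.2.map hf.measurable).trans ?_
    rw [heq]
    exact h2.1.map hf'.measurable
  have hac' : (baseMeasure Q).map (θ'.restrict O).f ≪ (baseMeasure Q).map (θ.restrict O).f := by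
    refine (h2.2.map hf'.measurable).trans ?_
    rw [← heq]
    exact h1.1.map hf.measurable
  refine ⟨hac, hac', exists_isUnit_affine_of_affine ?_ ?_⟩
  · exact VAEParam.exists_suffStat_eq_affine (θ := θ.restrict O) (θ' := θ'.restrict O) hQ hT hT'
      c.partitionFn_ne_zero c.partitionFn_ne_top c'.partitionFn_ne_zero c'.partitionFn_ne_top
      hf hf' heq hu
  · obtain ⟨A, b, h⟩ := VAEParam.exists_suffStat_eq_affine (θ := θ'.restrict O)
      (θ' := θ.restrict O) hQ hT' hT
      c'.partitionFn_ne_zero c'.partitionFn_ne_top c.partitionFn_ne_zero c.partitionFn_ne_top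
      hf' hf (fun u => (heq u).symm) hu'
    -- The reverse relation holds a.e. for the image under the second map; absolute continuity
    -- carries it over.
    exact ⟨A, b, hac.ae_le h⟩
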